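/- Let $p$ be a prime number and let $A$ be a discrete valuation ring with uniformizer $p$ and perfect residue field. Assume that $A$ has a $p$-derivation, i.e. a map of sets $\delta : A \to A$ such that $x \mapsto x^p + p\,\delta(x)$ is a ring homomorphism $A \to A$. Let $S = A[x_1,\dots,x_m]$ be graded by giving $A$ degree $0$ and each $x_i$ an integer degree $\deg(x_i) > 0$. Let $f_1,\dots,f_t \in S$ be homogeneous, and let $D \geq 1$ be an integer with $\deg(f_i) \leq D$ for all $i$ (for example $D = \max_i \deg(f_i)$, if this maximum is positive). Assume that the graded subring $R = A[f_1,\dots,f_t]$ is a graded direct summand of $S$, i.e. that there is a degree-preserving $R$-linear map $\beta : S \to R$ with $\beta(r) = r$ for all $r \in R$. Let $\mathfrak{m} = (p, f_1,\dots,f_t)R$. Then $$Q^{(nD)} \subseteq \mathfrak{m}^n$$ for every integer $n \geq 1$ and every homogeneous prime ideal $Q$ of $R$, where $Q^{(k)} = Q^k R_Q \cap R$ denotes the $k$-th symbolic power of $Q$. -/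

import Mathlib

/-- `δ` is a `p`-derivation on the ring `S`: `p` is a nonzerodivisor on `S` and
`x ↦ x ^ p + p * δ x` is a ring homomorphism (a lift of Frobenius). -/
structure IsPDerivation {S : Type*} [CommRing S] (p : ℕ) (δ : S → S) : Prop where
  mem_nonZeroDivisors : (p : S) ∈ nonZeroDivisors S
  exists_ringHom : ∃ φ : S →+* S, ∀ x, φ x = x ^ p + (p : S) * δ x

/-- The `n`-th symbolic power `Q ^ n R_Q ∩ R` of a prime ideal `Q` of `R`. -/
def Ideal.primeSymbolicPower {R : Type*} [CommRing R] (Q : Ideal R) [Q.IsPrime] (n : ℕ) :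
    Ideal R :=
  ((Q ^ n).map (algebraMap R (Localization.AtPrime Q))).comap
    (algebraMap R (Localization.AtPrime Q))

namespace GradedSubring

variable {A : Type*} [CommRing A] {m : ℕ}

/-- The polynomial ring `S = A[x_1, …, x_m]` is graded by `deg x_i = w i` (and `deg a = 0` for
`a ∈ A`). The `A`-subalgebra `R` is a graded direct summand of `S` if there is an `R`-linear map
`β : S → R` which preserves degrees and restricts to the identity on `R`. -/
def IsGradedDirectSummand (w : Fin m → ℕ) (R : Subalgebra A (MvPolynomial (Fin m) A)) : Prop :=
  ∃ β : MvPolynomial (Fin m) A →ₗ[R] R,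
    (∀ r : R, β (r : MvPolynomial (Fin m) A) = r) ∧
    ∀ (d : ℕ) (s : MvPolynomial (Fin m) A), MvPolynomial.IsWeightedHomogeneous w s d →
      MvPolynomial.IsWeightedHomogeneous w (β s : MvPolynomial (Fin m) A) d

/-- An ideal `Q` of the subalgebra `R` is homogeneous if, for each of its elements, every
homogeneous component (with respect to the grading `deg x_i = w i`) lies again in `Q`. -/
def IsHomogeneousIdeal (w : Fin m → ℕ) {R : Subalgebra A (MvPolynomial (Fin m) A)}
    (Q : Ideal R) : Prop :=
  ∀ x ∈ Q, ∀ d : ℕ, ∃ y ∈ Q, (y : MvPolynomial (Fin m) A) =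
    MvPolynomial.weightedHomogeneousComponent w d (x : MvPolynomial (Fin m) A)

/-- The generator `f i`, viewed as an element of `R = A[f_1, …, f_t]`. -/
def gen {t : ℕ} (f : Fin t → MvPolynomial (Fin m) A) (i : Fin t) :
    Algebra.adjoin A (Set.range f) :=
  ⟨f i, Algebra.subset_adjoin (Set.mem_range_self i)⟩

end GradedSubring

/-! Write `T_k` for `Q.symbolicExtension S k`, the contraction to `S` of `(QS)^k` after inverting `R
\ Q`. A divided partial derivative of order `k` sends `T_n` into `T_{n-k}`, and `δ y = (φ y -
y^p)/p` loses only one order on powers of `QS` when `p ∈ Q`.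

Let `r ∈ Q^{(nD)}` have coefficient `c_α` at `x^α`. Then `c_α` is the degree-0 part of the `α`-th
divided derivative of `r`; as the `T_k` are homogeneous, `c_α ∈ T_{nD-|α|}`
(`C_coeff_mem_symbolicExtension`). Constants in `T_k` are divisible by `p^k`
(`natCast_pow_dvd_of_C_mem_symbolicExtension`): if `p ∈ Q`, applying `δ` reduces `p^i ∈ T_{i+1}` to
`1 ∈ T_1`, against `QS ∩ R = Q`. All weights are at least 1, so the degree-`e` part of `r` is
`p^{nD-e} g`, and `β` moves `g` into `R`. Degree-`e` elements of `R` lie in `𝔪^⌈e/D⌉`, and `(nD-e) +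
⌈e/D⌉ ≥ n`. -/

/-- The ideal of all `g : S` with `s g ∈ (Q S) ^ n` for some `s : R` outside the prime `Q`. -/
def Ideal.symbolicExtension {R : Type*} (S : Type*) [CommRing R] [CommRing S] [Algebra R S]
    (Q : Ideal R) [Q.IsPrime] (n : ℕ) : Ideal S where
  carrier := {g | ∃ s : R, s ∉ Q ∧ algebraMap R S s * g ∈ Q.map (algebraMap R S) ^ n}
  zero_mem' := ⟨1, Q.primeCompl.one_mem, by simp⟩
  add_mem' := by
    rintro a b ⟨s, hs, ha⟩ ⟨u, hu, hb⟩
    refine ⟨s * u, Q.primeCompl.mul_mem hs hu, ?_⟩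
    have h := add_mem (Ideal.mul_mem_left _ (algebraMap R S u) ha)
      (Ideal.mul_mem_left _ (algebraMap R S s) hb)
    convert h using 1
    rw [map_mul]
    ring
  smul_mem' := by
    rintro c a ⟨s, hs, ha⟩
    refine ⟨s, hs, ?_⟩
    rw [smul_eq_mul, mul_left_comm]
    exact Ideal.mul_mem_left _ c ha

namespace Ideal

/-! ### The filtration of `S` by extended symbolic powers. -/

section SymbolicExtension

variable {R S : Type*} [CommRing R] [CommRing S] [Algebra R S] (Q : Ideal R) [Q.IsPrime]

lemma pow_map_le_symbolicExtension (n : ℕ) :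
    Q.map (algebraMap R S) ^ n ≤ Q.symbolicExtension S n := fun g hg ↦
  ⟨1, Q.primeCompl.one_mem, by simpa using hg⟩

lemma symbolicExtension_zero : Q.symbolicExtension S 0 = ⊤ := by
  simpa using Q.pow_map_le_symbolicExtension (S := S) 0

lemma symbolicExtension_antitone : Antitone (Q.symbolicExtension S) := by
  rintro a b hab g ⟨s, hs, hg⟩
  exact ⟨s, hs, Ideal.pow_le_pow_right hab hg⟩

lemma mul_mem_symbolicExtension {a b : ℕ} {g h : S} (hg : g ∈ Q.symbolicExtension S a)
    (hh : h ∈ Q.symbolicExtension S b) : g * h ∈ Q.symbolicExtension S (a + b) := by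
  obtain ⟨s, hs, hg⟩ := hg
  obtain ⟨u, hu, hh⟩ := hh
  refine ⟨s * u, Q.primeCompl.mul_mem hs hu, ?_⟩
  rw [map_mul, mul_mul_mul_comm, pow_add]
  exact Ideal.mul_mem_mul hg hh

lemma mem_symbolicExtension_of_algebraMap_mul_mem {n : ℕ} {s : R} (hs : s ∉ Q) {g : S}
    (h : algebraMap R S s * g ∈ Q.symbolicExtension S n) : g ∈ Q.symbolicExtension S n := by
  obtain ⟨u, hu, h⟩ := h
  refine ⟨u * s, Q.primeCompl.mul_mem hu hs, ?_⟩
  rwa [map_mul, mul_assoc]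

lemma algebraMap_mem_symbolicExtension_of_mem_primeSymbolicPower {n : ℕ} {r : R}
    (h : r ∈ Q.primeSymbolicPower n) : algebraMap R S r ∈ Q.symbolicExtension S n := by
  rw [primeSymbolicPower, mem_comap,
    IsLocalization.algebraMap_mem_map_algebraMap_iff Q.primeCompl] at h
  obtain ⟨s, hs, h⟩ := h
  refine ⟨s, hs, ?_⟩
  rw [← map_mul, ← Ideal.map_pow]
  exact mem_map_of_mem _ h

/-- By linearity `β` carries `IS` into `I`. This supplies `QS ∩ R = Q`. -/
lemma mem_of_algebraMap_mem_map_of_retraction (β : S →ₗ[R] R)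
    (hβ : ∀ r, β (algebraMap R S r) = r) (I : Ideal R) {r : R}
    (h : algebraMap R S r ∈ I.map (algebraMap R S)) : r ∈ I := by
  have key : ∀ x ∈ I.map (algebraMap R S), ∀ y, β (y * x) ∈ I := by
    intro x hx
    induction hx using Submodule.span_induction with
    | mem x hx =>
      obtain ⟨q, hq, rfl⟩ := hx
      intro y
      rw [mul_comm, ← Algebra.smul_def, map_smul, smul_eq_mul]
      exact I.mul_mem_right _ hq
    | zero => simp
    | add a b _ _ ha hb => exact fun y ↦ by simpa [mul_add] using add_mem (ha y) (hb y)
    | smul c a _ ha => exact fun y ↦ by simpa [mul_assoc] using ha (y * c)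
  simpa [hβ] using key _ h 1

open Polynomial in
/-- A polynomial over `R` with some coefficient outside `Q` acts injectively modulo the
coefficientwise extension of `Q.symbolicExtension S n`. -/
lemma coeff_mem_symbolicExtension_of_mul {n : ℕ} {u g : S[X]}
    (hu : ∃ i, ∃ s : R, s ∉ Q ∧ u.coeff i = algebraMap R S s)
    (h : ∀ i, (u * g).coeff i ∈ Q.symbolicExtension S n) (i : ℕ) :
    g.coeff i ∈ Q.symbolicExtension S n := by
  set T := Q.symbolicExtension S n
  let π := Ideal.Quotient.mk T
  have hug : u.map π * g.map π = 0 := by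
    rw [← Polynomial.map_mul]
    ext j
    rw [coeff_map, coeff_zero]
    exact Ideal.Quotient.eq_zero_iff_mem.2 (h j)
  -- McCoy's theorem: a zero divisor in a polynomial ring is killed by a nonzero constant. That
  -- constant would be killed by `s`, which is regular modulo `T`.
  have hreg : u.map π ∈ nonZeroDivisors (S ⧸ T)[X] := by
    by_contra hcon
    obtain ⟨a, ha, hau⟩ := Polynomial.notMem_nonZeroDivisors_iff.1 hcon
    obtain ⟨a, rfl⟩ := Ideal.Quotient.mk_surjective a
    obtain ⟨j, s, hs, hj⟩ := hu
    refine ha (Ideal.Quotient.eq_zero_iff_mem.2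
      (Q.mem_symbolicExtension_of_algebraMap_mul_mem hs ?_))
    have := congrArg (fun P ↦ coeff P j) hau
    simp only [coeff_smul, coeff_map, coeff_zero, smul_eq_mul, hj] at this
    rw [mul_comm]
    rw [← map_mul] at this
    exact Ideal.Quotient.eq_zero_iff_mem.1 this
  have hg := (mul_left_mem_nonZeroDivisors_eq_zero_iff hreg).1 hug
  have := congrArg (fun P ↦ coeff P i) hg
  simp only [coeff_map, coeff_zero] at this
  exact Ideal.Quotient.eq_zero_iff_mem.1 this

end SymbolicExtension

/-! ### Frobenius lifts and powers of `p`. -/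

section FrobeniusLift

variable {S : Type*} [CommRing S] {p : ℕ} {φ : S →+* S} {I : Ideal S}

/-- A Frobenius lift `φ` satisfies `φ y - y ^ p ∈ p I ^ n` for all `y ∈ I ^ (n + 1)`, if
`p ∈ I`. -/
lemma exists_frobeniusLift_sub_pow_eq (hp : p.Prime) (hφ : ∀ x, ∃ h, φ x - x ^ p = p * h)
    (hpI : (p : S) ∈ I) (n : ℕ) {y : S} (hy : y ∈ I ^ (n + 1)) :
    ∃ g ∈ I ^ n, φ y - y ^ p = p * g := by
  induction n generalizing y with
  | zero => simpa using hφ y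
  | succ n ih =>
    rw [pow_succ'] at hy
    induction hy using Submodule.mul_induction_on' with
    | mem_mul_mem a ha b hb =>
      obtain ⟨ga, hga⟩ := hφ a
      obtain ⟨gb, hgb, hb'⟩ := ih hb
      -- The product rule `δ(ab) = φ(a) δ(b) + b^p δ(a)`.
      refine ⟨φ a * gb + b ^ p * ga, add_mem ?_ ?_, ?_⟩
      · rw [pow_succ']
        refine Ideal.mul_mem_mul ?_ hgb
        rw [eq_add_of_sub_eq hga]
        exact add_mem (I.mul_mem_right _ hpI) (I.pow_mem_of_mem ha p hp.pos)
      · exact Ideal.mul_mem_right _ _ (Ideal.pow_mem_of_mem _ hb p hp.pos)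
      · rw [map_mul, mul_pow]
        linear_combination φ a * hb' + b ^ p * hga
    | add x hx y hy hx' hy' =>
      obtain ⟨gx, hgx, hx'⟩ := hx'
      obtain ⟨gy, hgy, hy'⟩ := hy'
      obtain ⟨r, hr⟩ := exists_add_pow_prime_eq hp x y
      refine ⟨gx + gy - x * y * r, sub_mem (add_mem hgx hgy) ?_, ?_⟩
      · rw [← pow_succ'] at hx
        exact Ideal.mul_mem_right _ _ (Ideal.mul_mem_right _ _ (Ideal.pow_le_pow_right (by lia) hx))
      · rw [map_add, hr]
        linear_combination hx' + hy'

/-- Apply `δ` to `s p^(i+1)`: up to multiples of `p^(i+1)`, which lie in `I^(i+1)`, the result is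
`s^p p^i`. -/
lemma pow_mul_pow_mem_of_mul_pow_succ_mem (hp : p.Prime) (hφ : ∀ x, ∃ h, φ x - x ^ p = p * h)
    (hpS : (p : S) ∈ nonZeroDivisors S) (hpI : (p : S) ∈ I) (i : ℕ) {s : S}
    (hs : s * (p : S) ^ (i + 1) ∈ I ^ (i + 2)) : s ^ p * (p : S) ^ i ∈ I ^ (i + 1) := by
  obtain ⟨g, hg, h⟩ := exists_frobeniusLift_sub_pow_eq hp hφ hpI (i + 1) hs
  obtain ⟨u, hu⟩ := hφ s
  obtain ⟨j, hj⟩ : ∃ j, (i + 1) * p = (i + 1 + j) + 1 := by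
    have h2 := hp.two_le
    have : (i + 1) * 2 ≤ (i + 1) * p := Nat.mul_le_mul_left _ h2
    exact ⟨(i + 1) * p - (i + 2), by lia⟩
  have hpp : (p : S) ^ (i + 1) ∈ I ^ (i + 1) := Ideal.pow_mem_pow hpI _
  have h' : φ s * (p : S) ^ i - s ^ p * (p : S) ^ (i + 1 + j) = g := by
    have h0 : (p : S) * (φ s * (p : S) ^ i - s ^ p * (p : S) ^ (i + 1 + j) - g) = 0 := by
      rw [map_mul, map_pow, map_natCast, mul_pow, ← pow_mul, hj] at h
      linear_combination h
    exact sub_eq_zero.1 ((mul_left_mem_nonZeroDivisors_eq_zero_iff hpS).1 h0)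
  have h'' : s ^ p * (p : S) ^ i
      = g + s ^ p * (p : S) ^ j * (p : S) ^ (i + 1) - u * (p : S) ^ (i + 1) := by
    rw [← h']
    linear_combination -(p : S) ^ i * hu
  rw [h'']
  exact sub_mem (add_mem hg (Ideal.mul_mem_left _ _ hpp)) (Ideal.mul_mem_left _ _ hpp)

/-- In the presence of a Frobenius lift, `p ^ i` does not lie in the extension of the symbolic
power `Q ^ (i + 1)`. -/
lemma natCast_pow_notMem_symbolicExtension {R : Type*} [CommRing R] [Algebra R S] (Q : Ideal R)
    [Q.IsPrime] (hp : p.Prime) (hφ : ∀ x, ∃ h, φ x - x ^ p = p * h)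
    (hpS : (p : S) ∈ nonZeroDivisors S) (hpQ : (p : R) ∈ Q)
    (hQ : ∀ r, algebraMap R S r ∈ Q.map (algebraMap R S) → r ∈ Q) (i : ℕ) :
    (p : S) ^ i ∉ Q.symbolicExtension S (i + 1) := by
  have hpI : (p : S) ∈ Q.map (algebraMap R S) := by
    simpa using mem_map_of_mem (algebraMap R S) hpQ
  induction i with
  | zero =>
    rintro ⟨s, hs, h⟩
    exact hs (hQ s (by simpa using h))
  | succ i ih =>
    rintro ⟨s, hs, h⟩
    refine ih ⟨s ^ p, fun hcon ↦ hs (‹Q.IsPrime›.mem_of_pow_mem p hcon), ?_⟩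
    rw [map_pow]
    exact pow_mul_pow_mem_of_mul_pow_succ_mem hp hφ hpS hpI i h

end FrobeniusLift

end Ideal

/-! ### Gradings and divided derivatives on polynomial rings. -/

namespace MvPolynomial

variable {σ A : Type*} [CommRing A]

/-- The homomorphism `A[x] → A[x][t]`, `x i ↦ x i * t ^ w i`, which separates the weighted
homogeneous components. -/
noncomputable def gradingHom (w : σ → ℕ) : MvPolynomial σ A →ₐ[A] Polynomial (MvPolynomial σ A) :=
  aeval fun i ↦ Polynomial.monomial (w i) (X i)

lemma gradingHom_monomial (w : σ → ℕ) (α : σ →₀ ℕ) (a : A) :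
    gradingHom w (monomial α a) = Polynomial.monomial (Finsupp.weight w α) (monomial α a) := by
  have key : ∀ α : σ →₀ ℕ, gradingHom w (monomial α (1 : A)) =
      Polynomial.monomial (Finsupp.weight w α) (monomial α 1) := by
    intro α
    induction α using Finsupp.induction_linear with
    | zero => simp
    | add α β hα hβ =>
      have h : monomial (α + β) (1 : A) = monomial α 1 * monomial β 1 := by
        rw [monomial_mul, one_mul]
      rw [h, map_mul, hα, hβ, Polynomial.monomial_mul_monomial, map_add]
    | single i k =>
      have h : monomial (Finsupp.single i k) (1 : A) = X i ^ k := by rw [X_pow_eq_monomial]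
      rw [h, map_pow, gradingHom, aeval_X, Polynomial.monomial_pow, Finsupp.weight_single,
        smul_eq_mul, mul_comm]
  have h : monomial α a = a • monomial α (1 : A) := by rw [smul_monomial, smul_eq_mul, mul_one]
  rw [h, map_smul, key, Polynomial.smul_monomial]

lemma coeff_gradingHom (w : σ → ℕ) (e : ℕ) (g : MvPolynomial σ A) :
    (gradingHom w g).coeff e = weightedHomogeneousComponent w e g := by
  classical
  induction g using MvPolynomial.induction_on' with
  | monomial α a =>
    rw [gradingHom_monomial, Polynomial.coeff_monomial,
      weightedHomogeneousComponent_of_mem (isWeightedHomogeneous_monomial w α a rfl)]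
    simp only [eq_comm]
  | add p q hp hq => rw [map_add, Polynomial.coeff_add, hp, hq, map_add]

lemma weightedHomogeneousComponent_mul (w : σ → ℕ) (e : ℕ) (g h : MvPolynomial σ A) :
    weightedHomogeneousComponent w e (g * h) = ∑ x ∈ Finset.HasAntidiagonal.antidiagonal e,
      weightedHomogeneousComponent w x.1 g * weightedHomogeneousComponent w x.2 h := by
  simp only [← coeff_gradingHom, map_mul, Polynomial.coeff_mul]

/-- The Taylor expansion `A[x] → A[x][y]`, `x i ↦ x i + y i`, whose coefficients are the
divided partial derivatives. -/
noncomputable def taylorHom : MvPolynomial σ A →ₐ[A] MvPolynomial σ (MvPolynomial σ A) :=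
  aeval fun i ↦ C (X i) + X i

lemma coeff_zero_taylorHom (g : MvPolynomial σ A) : coeff 0 (taylorHom g) = g := by
  have h : (constantCoeff.comp (taylorHom (σ := σ) (A := A)).toRingHom) = RingHom.id _ := by
    ext i
    · simp [taylorHom, algebraMap_eq, MvPolynomial.algebraMap_apply]
    · simp [taylorHom]
  exact DFunLike.congr_fun h g

/-- Setting `x = 0` in `g(x + y)` gives `g(y)`. -/
lemma constantCoeff_coeff_taylorHom (α : σ →₀ ℕ) (g : MvPolynomial σ A) :
    constantCoeff (coeff α (taylorHom g)) = coeff α g := by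
  have h : (map constantCoeff).comp (taylorHom (σ := σ) (A := A)).toRingHom = RingHom.id _ := by
    ext i
    · simp [taylorHom, algebraMap_eq, MvPolynomial.algebraMap_apply]
    · simp [taylorHom]
  rw [← coeff_map]
  exact congrArg (coeff α) (DFunLike.congr_fun h g)

section Filtration

variable {R : Type*} [CommRing R] [Algebra R (MvPolynomial σ A)] (Q : Ideal R)

/-- `gradingHom` sends `I` into `I S[t]`, hence `I^n` into `I^n S[t]`, where membership is tested on
coefficients. -/
lemma weightedHomogeneousComponent_mem_map_pow {w : σ → ℕ}
    (hQ : ∀ q ∈ Q, ∀ e, weightedHomogeneousComponent w e (algebraMap R (MvPolynomial σ A) q) ∈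
      Q.map (algebraMap R (MvPolynomial σ A))) {n : ℕ} {g : MvPolynomial σ A}
    (hg : g ∈ Q.map (algebraMap R (MvPolynomial σ A)) ^ n) (e : ℕ) :
    weightedHomogeneousComponent w e g ∈ Q.map (algebraMap R (MvPolynomial σ A)) ^ n := by
  set I := Q.map (algebraMap R (MvPolynomial σ A))
  have hI : I.map (gradingHom w (A := A)) ≤ I.map Polynomial.C := by
    rw [Ideal.map_le_iff_le_comap, Ideal.map_le_iff_le_comap]
    intro q hq
    rw [Ideal.mem_comap, Ideal.mem_comap, Ideal.mem_map_C_iff]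
    intro e
    rw [coeff_gradingHom]
    exact hQ q hq e
  have h := Ideal.mem_map_of_mem (gradingHom w (A := A)) hg
  rw [Ideal.map_pow] at h
  have h := Ideal.pow_right_mono hI n h
  rw [← Ideal.map_pow, Ideal.mem_map_C_iff] at h
  rw [← coeff_gradingHom]
  exact h e

variable [Q.IsPrime]

/-- The `A`-linear differential operators of order `k` map `(Q S) ^ n` into the extension of the
symbolic power `n - k` of `Q`. -/
lemma coeff_taylorHom_mem_of_mem_pow {n : ℕ} {g : MvPolynomial σ A}
    (hg : g ∈ Q.map (algebraMap R (MvPolynomial σ A)) ^ n) (α : σ →₀ ℕ) :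
    coeff α (taylorHom g) ∈ Q.symbolicExtension (MvPolynomial σ A) (n - α.degree) := by
  classical
  induction n generalizing g α with
  | zero => simp [Ideal.symbolicExtension_zero]
  | succ n ih =>
    rw [pow_succ'] at hg
    induction hg using Submodule.mul_induction_on' with
    | mem_mul_mem a ha b hb =>
      rw [map_mul, coeff_mul]
      refine Ideal.sum_mem _ fun x hx ↦ ?_
      have hx' := congrArg Finsupp.degree (Finset.HasAntidiagonal.mem_antidiagonal.1 hx)
      rw [map_add] at hx'
      -- In the Leibniz sum, either `a` is not differentiated and contributes one order, or at least
      -- one derivative is spent on it.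
      by_cases h0 : x.1 = 0
      · rw [h0, coeff_zero_taylorHom]
        have ha' : a ∈ Q.symbolicExtension (MvPolynomial σ A) 1 :=
          Q.pow_map_le_symbolicExtension 1 (by simpa using ha)
        refine Q.symbolicExtension_antitone ?_ (Q.mul_mem_symbolicExtension ha' (ih hb x.2))
        lia
      · refine Q.symbolicExtension_antitone ?_ (Ideal.mul_mem_left _ _ (ih hb x.2))
        have : x.1.degree ≠ 0 := by simpa [Finsupp.degree_eq_zero_iff] using h0
        lia
    | add x _ y _ hx hy => rw [map_add, coeff_add]; exact add_mem hx hy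

lemma coeff_taylorHom_mem_symbolicExtension {n : ℕ} {g : MvPolynomial σ A}
    (hg : g ∈ Q.symbolicExtension (MvPolynomial σ A) n) (α : σ →₀ ℕ) :
    coeff α (taylorHom g) ∈ Q.symbolicExtension (MvPolynomial σ A) (n - α.degree) := by
  classical
  obtain ⟨s, hs, hsg⟩ := hg
  induction hk : α.degree using Nat.strong_induction_on generalizing α with
  | _ k ih =>
    subst hk
    refine Q.mem_symbolicExtension_of_algebraMap_mul_mem hs ?_
    have h := coeff_taylorHom_mem_of_mem_pow Q hsg α
    have h0 : ((0, α) : (σ →₀ ℕ) × (σ →₀ ℕ)) ∈ Finset.HasAntidiagonal.antidiagonal α := by simp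
    rw [map_mul, coeff_mul, ← Finset.add_sum_erase _ _ h0, coeff_zero_taylorHom] at h
    -- All Leibniz terms other than `s` times the `α`-th derivative of `g` involve lower derivatives
    -- of `g`, covered by induction.
    refine (Ideal.add_mem_iff_left _ (Ideal.sum_mem _ fun x hx ↦ Ideal.mul_mem_left _ _ ?_)).1 h
    obtain ⟨hne, hx⟩ := Finset.mem_erase.1 hx
    have hx := Finset.HasAntidiagonal.mem_antidiagonal.1 hx
    have h1 : x.1.degree ≠ 0 := by
      intro h1
      rw [Finsupp.degree_eq_zero_iff] at h1
      refine hne (Prod.ext h1 ?_)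
      simpa [h1] using hx
    have hx' := congrArg Finsupp.degree hx
    rw [map_add] at hx'
    exact Q.symbolicExtension_antitone (by lia) (ih x.2.degree (by lia) x.2 rfl)

/-- The extension of a symbolic power of a homogeneous prime is homogeneous. -/
lemma weightedHomogeneousComponent_mem_symbolicExtension {w : σ → ℕ}
    (hR : ∀ r : R, ∀ e, ∃ s : R, algebraMap R (MvPolynomial σ A) s =
      weightedHomogeneousComponent w e (algebraMap R (MvPolynomial σ A) r))
    (hQ : ∀ q ∈ Q, ∀ e, weightedHomogeneousComponent w e (algebraMap R (MvPolynomial σ A) q) ∈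
      Q.map (algebraMap R (MvPolynomial σ A)))
    (hQ' : ∀ r, algebraMap R (MvPolynomial σ A) r ∈ Q.map (algebraMap R (MvPolynomial σ A)) →
      r ∈ Q)
    {n : ℕ} {g : MvPolynomial σ A}
    (hg : g ∈ Q.symbolicExtension (MvPolynomial σ A) n) (e : ℕ) :
    weightedHomogeneousComponent w e g ∈ Q.symbolicExtension (MvPolynomial σ A) n := by
  obtain ⟨s, hs, hsg⟩ := hg
  rw [← coeff_gradingHom]
  refine Q.coeff_mem_symbolicExtension_of_mul
    (u := gradingHom w (algebraMap R (MvPolynomial σ A) s)) ?_ ?_ e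
  -- The multiplier `s` need not be homogeneous, but some component of it lies outside `Q`.
  · by_contra! hcon
    refine hs (hQ' s ?_)
    rw [← finsum_weightedHomogeneousComponent w (algebraMap R (MvPolynomial σ A) s)]
    refine finsum_induction (· ∈ Q.map (algebraMap R (MvPolynomial σ A))) (zero_mem _)
      (fun _ _ ↦ add_mem) fun e ↦ ?_
    obtain ⟨r, hr⟩ := hR s e
    rw [← hr]
    refine Ideal.mem_map_of_mem _ (by_contra fun hrQ ↦ hcon e r hrQ ?_)
    rw [coeff_gradingHom, hr]
  · intro i
    rw [← map_mul, coeff_gradingHom]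
    exact Q.pow_map_le_symbolicExtension n (weightedHomogeneousComponent_mem_map_pow Q hQ hsg i)

/-- The coefficient of `x ^ α` in an element of the extension of the symbolic power `n` of a
homogeneous prime lies in the extension of the symbolic power `n - |α|`. -/
lemma C_coeff_mem_symbolicExtension {w : σ → ℕ} (hw : ∀ i, 0 < w i)
    (hR : ∀ r : R, ∀ e, ∃ s : R, algebraMap R (MvPolynomial σ A) s =
      weightedHomogeneousComponent w e (algebraMap R (MvPolynomial σ A) r))
    (hQ : ∀ q ∈ Q, ∀ e, weightedHomogeneousComponent w e (algebraMap R (MvPolynomial σ A) q) ∈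
      Q.map (algebraMap R (MvPolynomial σ A)))
    (hQ' : ∀ r, algebraMap R (MvPolynomial σ A) r ∈ Q.map (algebraMap R (MvPolynomial σ A)) →
      r ∈ Q)
    {n : ℕ} {g : MvPolynomial σ A}
    (hg : g ∈ Q.symbolicExtension (MvPolynomial σ A) n) (α : σ →₀ ℕ) :
    C (coeff α g) ∈ Q.symbolicExtension (MvPolynomial σ A) (n - α.degree) := by
  have h := weightedHomogeneousComponent_mem_symbolicExtension Q hR hQ hQ'
    (coeff_taylorHom_mem_symbolicExtension Q hg α) 0
  rw [weightedHomogeneousComponent_zero _ fun i ↦ (hw i).ne'] at h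
  rwa [← constantCoeff_coeff_taylorHom α g]

end Filtration

/-- A Frobenius lift on `A` extends to `A[x]` by `x i ↦ x i ^ p`. -/
lemma exists_frobeniusLift {p : ℕ} (hp : p.Prime) {φ : A →+* A}
    (hφ : ∀ a, ∃ h, φ a - a ^ p = p * h) :
    ∃ Φ : MvPolynomial σ A →+* MvPolynomial σ A, ∀ g, ∃ h, Φ g - g ^ p = p * h := by
  refine ⟨eval₂Hom (C.comp φ) fun i ↦ X i ^ p, fun g ↦ ?_⟩
  induction g using MvPolynomial.induction_on with
  | C a =>
    obtain ⟨h, hh⟩ := hφ a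
    refine ⟨C h, ?_⟩
    simp only [coe_eval₂Hom, eval₂_C, RingHom.coe_comp, Function.comp_apply]
    rw [← map_pow, ← map_sub, hh, map_mul, map_natCast]
  | add f g hf hg =>
    obtain ⟨f', hf⟩ := hf
    obtain ⟨g', hg⟩ := hg
    obtain ⟨r, hr⟩ := exists_add_pow_prime_eq hp f g
    refine ⟨f' + g' - f * g * r, ?_⟩
    rw [map_add, hr]
    linear_combination hf + hg
  | mul_X f i hf =>
    obtain ⟨f', hf⟩ := hf
    refine ⟨X i ^ p * f', ?_⟩
    rw [map_mul, mul_pow, coe_eval₂Hom, eval₂_X, ← coe_eval₂Hom]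
    linear_combination X i ^ p * hf

end MvPolynomial

open MvPolynomial in
/-- Over a discrete valuation ring with uniformizer `p` and a Frobenius lift, a constant in the
extension of the symbolic power `n` of a prime of a direct summand is divisible by `p ^ n`. -/
lemma MvPolynomial.natCast_pow_dvd_of_C_mem_symbolicExtension {σ A R : Type*} [CommRing A]
    [IsDomain A] [IsDiscreteValuationRing A] [CommRing R] [Algebra R (MvPolynomial σ A)]
    (Q : Ideal R) [Q.IsPrime] {p : ℕ} (hp : p.Prime) (hpA : Irreducible (p : A))
    {φ : A →+* A} (hφ : ∀ a, ∃ h, φ a - a ^ p = p * h)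
    (hQ : ∀ r, algebraMap R (MvPolynomial σ A) r ∈ Q.map (algebraMap R (MvPolynomial σ A)) →
      r ∈ Q) {n : ℕ} {c : A} (hc : C c ∈ Q.symbolicExtension (MvPolynomial σ A) n) :
    (p : A) ^ n ∣ c := by
  by_contra hcon
  have hc0 : c ≠ 0 := by
    rintro rfl
    exact hcon (dvd_zero _)
  obtain ⟨i, hi⟩ := IsDiscreteValuationRing.associated_pow_irreducible hc0 hpA
  have hin : i + 1 ≤ n := by
    by_contra! h
    exact hcon ((pow_dvd_pow _ (by lia)).trans hi.symm.dvd)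
  have hpi : (p : MvPolynomial σ A) ^ i ∈ Q.symbolicExtension (MvPolynomial σ A) (i + 1) := by
    refine Q.symbolicExtension_antitone hin (Ideal.mem_of_dvd _ ?_ hc)
    simpa using map_dvd (C (σ := σ)) hi.dvd
  by_cases hpQ : (p : R) ∈ Q
  · obtain ⟨Φ, hΦ⟩ := exists_frobeniusLift (σ := σ) hp hφ
    refine Ideal.natCast_pow_notMem_symbolicExtension Q hp hΦ ?_ hpQ hQ i hpi
    refine mem_nonZeroDivisors_of_ne_zero ?_
    rw [← map_natCast (C (σ := σ)), Ne, C_eq_zero]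
    exact hpA.ne_zero
  -- If `p ∉ Q`, then `s p^i ∉ Q`, although it lies in `QS ∩ R`.
  · obtain ⟨s, hs, h⟩ := Q.symbolicExtension_antitone (Nat.le_add_left 1 i) hpi
    refine Q.primeCompl.mul_mem hs (Q.primeCompl.pow_mem hpQ i) (hQ _ ?_)
    simpa using h

/-! ### Degrees in `R` and the final count. -/

namespace GradedSubring

open MvPolynomial

variable {A : Type*} [CommRing A] {m t : ℕ}

/-- The component of degree `e` of an element of `A[f_1, …, f_t]` lies in the power
`⌈e / D⌉` of any ideal containing all the `f_i`, if these have degrees at most `D`. -/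
lemma exists_mem_pow_ceilDiv_eq_weightedHomogeneousComponent {w : Fin m → ℕ}
    {f : Fin t → MvPolynomial (Fin m) A} {d : Fin t → ℕ}
    (hf : ∀ i, IsWeightedHomogeneous w (f i) (d i)) {D : ℕ} (hD : 0 < D) (hdD : ∀ i, d i ≤ D)
    {I : Ideal (Algebra.adjoin A (Set.range f))} (hI : ∀ i, gen f i ∈ I)
    {x : MvPolynomial (Fin m) A} (hx : x ∈ Algebra.adjoin A (Set.range f)) (e : ℕ) :
    ∃ y ∈ I ^ (e ⌈/⌉ D), (y : MvPolynomial (Fin m) A) = weightedHomogeneousComponent w e x := by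
  induction hx using Algebra.adjoin_induction generalizing e with
  | mem x hx =>
    obtain ⟨i, rfl⟩ := hx
    rw [weightedHomogeneousComponent_of_mem (hf i)]
    split_ifs with h
    · refine ⟨gen f i, Ideal.pow_le_pow_right (m := e ⌈/⌉ D) (n := 1) ?_ (by simpa using hI i), rfl⟩
      rw [ceilDiv_le_iff_le_mul hD, h, mul_one]
      exact hdD i
    · exact ⟨0, zero_mem _, rfl⟩
  | algebraMap a =>
    rw [algebraMap_eq, weightedHomogeneousComponent_of_mem (isWeightedHomogeneous_C w a)]
    split_ifs with h
    · refine ⟨algebraMap A _ a, ?_, rfl⟩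
      simp [h]
    · exact ⟨0, zero_mem _, rfl⟩
  | add x y _ _ hx hy =>
    obtain ⟨x', hx, hx'⟩ := hx e
    obtain ⟨y', hy, hy'⟩ := hy e
    exact ⟨x' + y', add_mem hx hy, by simp [hx', hy']⟩
  | mul x y _ _ hx hy =>
    choose x' hx hx' using hx
    choose y' hy hy' using hy
    refine ⟨∑ z ∈ Finset.HasAntidiagonal.antidiagonal e, x' z.1 * y' z.2,
      Ideal.sum_mem _ fun z hz ↦ ?_, ?_⟩
    · refine Ideal.pow_le_pow_right ?_ ((pow_add I _ _).symm ▸ Ideal.mul_mem_mul (hx z.1) (hy z.2))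
      rw [Finset.HasAntidiagonal.mem_antidiagonal] at hz
      rw [ceilDiv_le_iff_le_mul hD, mul_add, ← hz]
      exact add_le_add (le_smul_ceilDiv hD) (le_smul_ceilDiv hD)
    · rw [weightedHomogeneousComponent_mul]
      simp [hx', hy']

lemma degree_le_weight {w : Fin m → ℕ} (hw : ∀ i, 0 < w i) (α : Fin m →₀ ℕ) :
    α.degree ≤ Finsupp.weight w α := by
  rw [Finsupp.degree_eq_weight_one, Finsupp.weight_apply, Finsupp.weight_apply]
  exact Finsupp.sum_le_sum fun i _ ↦ Nat.mul_le_mul_left _ (hw i)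

end GradedSubring

open MvPolynomial GradedSubring in
theorem corollary3p5 {A : Type*} [CommRing A] [IsDomain A] [IsDiscreteValuationRing A]
    (p : ℕ) (hp : p.Prime) (hpA : Irreducible (p : A))
    [PerfectField (IsLocalRing.ResidueField A)]
    (hδ : ∃ δ : A → A, IsPDerivation p δ)
    (m t : ℕ) (w : Fin m → ℕ) (hw : ∀ i, 0 < w i)
    (f : Fin t → MvPolynomial (Fin m) A) (d : Fin t → ℕ)
    (hf : ∀ i, MvPolynomial.IsWeightedHomogeneous w (f i) (d i))
    (hR : GradedSubring.IsGradedDirectSummand w (Algebra.adjoin A (Set.range f)))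
    (D : ℕ) (hD : 0 < D) (hdD : ∀ i, d i ≤ D)
    (Q : Ideal (Algebra.adjoin A (Set.range f))) [Q.IsPrime]
    (hQ : GradedSubring.IsHomogeneousIdeal w Q) (n : ℕ) (hn : 1 ≤ n) :
    Q.primeSymbolicPower (n * D) ≤
      (Ideal.span (insert (p : Algebra.adjoin A (Set.range f))
        (Set.range (GradedSubring.gen f)))) ^ n := by
  obtain ⟨δ, hδ⟩ := hδ
  obtain ⟨φ, hφ⟩ := hδ.exists_ringHom
  obtain ⟨β, hβ, -⟩ := hR
  set 𝔪 := Ideal.span (insert (p : Algebra.adjoin A (Set.range f)) (Set.range (gen f)))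
  have hgen : ∀ i, gen f i ∈ 𝔪 := fun i ↦
    Ideal.subset_span (Set.mem_insert_of_mem _ (Set.mem_range_self i))
  have hp𝔪 : (p : Algebra.adjoin A (Set.range f)) ∈ 𝔪 := Ideal.subset_span (Set.mem_insert _ _)
  have hcomp : ∀ r : Algebra.adjoin A (Set.range f), ∀ e, ∃ y ∈ 𝔪 ^ (e ⌈/⌉ D),
      (y : MvPolynomial (Fin m) A) = weightedHomogeneousComponent w e r.1 := fun r e ↦
    exists_mem_pow_ceilDiv_eq_weightedHomogeneousComponent hf hD hdD hgen r.2 e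
  have hcontr := fun r ↦
    Ideal.mem_of_algebraMap_mem_map_of_retraction β hβ Q (r := r)
  intro x hx
  have hdvd : ∀ α, (p : A) ^ (n * D - α.degree) ∣ coeff α x.1 := fun α ↦
    natCast_pow_dvd_of_C_mem_symbolicExtension Q hp hpA
      (fun a ↦ ⟨δ a, by rw [hφ, add_sub_cancel_left]⟩) hcontr
      (C_coeff_mem_symbolicExtension Q hw
        (fun r e ↦ (hcomp r e).imp fun _ h ↦ h.2)
        (fun q hq e ↦ by
          obtain ⟨y, hy, h⟩ := hQ q hq e
          exact h ▸ Ideal.mem_map_of_mem (algebraMap _ _) hy) hcontr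
        (Q.algebraMap_mem_symbolicExtension_of_mem_primeSymbolicPower hx) α)
  choose y hy hyx using hcomp x
  have hmem : ∀ e, y e ∈ 𝔪 ^ n := by
    intro e
    obtain ⟨g, hg⟩ : C ((p : A) ^ (n * D - e)) ∣ (y e : MvPolynomial (Fin m) A) := by
      rw [C_dvd_iff_dvd_coeff]
      intro α
      rw [hyx, coeff_weightedHomogeneousComponent]
      split_ifs with h
      · exact (pow_dvd_pow _ (Nat.sub_le_sub_left (h ▸ degree_le_weight hw α) _)).trans (hdvd α)
      · exact dvd_zero _
    have hz : y e = (p : Algebra.adjoin A (Set.range f)) ^ (n * D - e) * β g := by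
      rw [← smul_eq_mul, ← map_smul, ← hβ (y e), hg, Algebra.smul_def]
      congr 2
      simp
    -- Since `y e` is homogeneous of degree `e`, `β g` may be replaced by its degree-`e` component,
    -- which lies in `𝔪 ^ (e ⌈/⌉ D)`.
    obtain ⟨z, hzm, hz'⟩ := hcomp (β g) e
    have hyz : y e = (p : Algebra.adjoin A (Set.range f)) ^ (n * D - e) * z := by
      apply Subtype.ext
      have h1 : weightedHomogeneousComponent w e (y e : MvPolynomial (Fin m) A) = y e := by
        rw [hyx]
        exact (weightedHomogeneousComponent_isWeightedHomogeneous _ _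
          ).weightedHomogeneousComponent_same
      have h2 : (y e : MvPolynomial (Fin m) A)
          = C ((p : A) ^ (n * D - e)) * (β g : MvPolynomial (Fin m) A) := by
        rw [hz]
        simp
      rw [← h1, h2, weightedHomogeneousComponent_C_mul, ← hz']
      simp
    rw [hyz]
    refine Ideal.pow_le_pow_right ?_
      ((pow_add 𝔪 _ _).symm ▸ Ideal.mul_mem_mul (Ideal.pow_mem_pow hp𝔪 (n * D - e)) hzm)
    have h1 : e ≤ D * (e ⌈/⌉ D) := le_smul_ceilDiv hD
    have h2 : n * D - e ≤ D * (n * D - e) := Nat.le_mul_of_pos_left _ hD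
    -- After multiplication by `D`, the exponent is at least `(nD - e) + e ≥ nD`, also when the
    -- subtraction truncates.
    refine Nat.le_of_mul_le_mul_left (c := D) ?_ hD
    rw [mul_add, mul_comm D n]
    lia
  have hfin : (Function.support y).Finite := by
    refine (weightedHomogeneousComponent_finsupp (w := w) x.1).subset fun e he ↦ ?_
    rw [Function.mem_support, ← hyx]
    simpa using he
  have hsum : x = ∑ᶠ e, y e := by
    apply Subtype.ext
    rw [← finsum_weightedHomogeneousComponent w x.1]
    simp only [← hyx]
    exact (AddMonoidHom.map_finsum (Algebra.adjoin A (Set.range f)).val.toAddMonoidHom hfin).symm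
  rw [hsum]
  exact finsum_induction (· ∈ 𝔪 ^ n) (zero_mem _) (fun _ _ ↦ add_mem) hmem
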